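/- Let $T$ be a finite tree that is not a star (a star being a tree with a vertex adjacent to all other vertices; in particular trees on at most three vertices are stars). Let $m_T$ be the maximum number of leaves of $T$ (vertices of degree one in $T$) that can be removed from $T$ so that the graph obtained is still a non-star tree. Let $T^5$ be the graph on $V(T)$ in which two distinct vertices are adjacent exactly when their distance in $T$ is at most $5$. A $p$-labeled-packing of $T$ into $T^5$ is a surjective map $f : V(T) \to \{1,\dots,p\}$ for which there is a permutation $\sigma$ of $V(T)$ such that, for every edge $xy$ of $T$, $\sigma(x)\sigma(y)$ is not an edge of $T$ but is an edge of $T^5$, and $f(\sigma(v)) = f(v)$ for every vertex $v$ of $T$. Let $w^5(T)$ be the maximum positive integer $p$ for which a $p$-labeled-packing of $T$ into $T^5$ exists. Then $w^5(T)$ is well defined and $$w^5(T) \ge m_T + 1.$$ -/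

import Mathlib

namespace LabeledPacking

/-- A star: some vertex (the centre) is joined to all the others, and there are no other edges.
The one-vertex graph and the one-edge graph are stars. -/
def IsStar {V : Type*} (G : SimpleGraph V) : Prop :=
  ∃ r : V, G = SimpleGraph.starGraph r

/-- A non-star tree. -/
def IsNonStarTree {V : Type*} (G : SimpleGraph V) : Prop :=
  G.IsTree ∧ ¬ IsStar G

/-- A leaf: a vertex of degree one, that is, with exactly one neighbour. -/
def IsLeaf {V : Type*} (G : SimpleGraph V) (v : V) : Prop :=
  ∃! w : V, G.Adj v w

/-- `U` is a set of leaves of `T` whose removal leaves a non-star tree. -/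
def IsRemovable {V : Type*} (T : SimpleGraph V) (U : Finset V) : Prop :=
  (∀ v ∈ U, IsLeaf T v) ∧ IsNonStarTree (T.induce {v : V | v ∉ U})

/-- `m_T`: the maximum number of leaves of `T` that can be removed so that the graph obtained is a
non-star tree. -/
noncomputable def maxRemovableLeaves {V : Type*} (T : SimpleGraph V) : ℕ :=
  sSup {m : ℕ | ∃ U : Finset V, IsRemovable T U ∧ U.card = m}

/-- The `k`-th power `G^k`: distinct vertices at distance at most `k` in `G` are joined. -/
def power {V : Type*} (G : SimpleGraph V) (k : ℕ) : SimpleGraph V where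
  Adj x y := x ≠ y ∧ G.edist x y ≤ (k : ℕ∞)
  symm := ⟨fun x y h => ⟨h.1.symm, by rw [SimpleGraph.edist_comm]; exact h.2⟩⟩
  loopless := ⟨fun _ h => h.1 rfl⟩

/-- `σ` is a 2-placement of `G`: the edge set of `G` and its image under `σ` are disjoint. -/
def IsTwoPlacement {V : Type*} (G : SimpleGraph V) (σ : Equiv.Perm V) : Prop :=
  ∀ x y : V, G.Adj x y → ¬ G.Adj (σ x) (σ y)

/-- `f` is a `p`-labeled-packing of `G` into `G^k`: all `p` labels occur, and there is a
2-placement `σ` of `G` with `σ(G) ⊆ G^k` that preserves the labels. -/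
def IsLabeledPacking {V : Type*} (G : SimpleGraph V) (k p : ℕ) (f : V → Fin p) : Prop :=
  Function.Surjective f ∧
    ∃ σ : Equiv.Perm V, IsTwoPlacement G σ ∧
      (∀ x y : V, G.Adj x y → (power G k).Adj (σ x) (σ y)) ∧
      ∀ v : V, f v = f (σ v)

/-- `w^k(G)`: the maximum positive integer `p` for which there is a `p`-labeled-packing of `G`
into `G^k` (and `0` if there is none). -/
noncomputable def labeledPackingNumber {V : Type*} (G : SimpleGraph V) (k : ℕ) : ℕ :=
  sSup {p : ℕ | 0 < p ∧ ∃ f : V → Fin p, IsLabeledPacking G k p f}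

/-- On a finite vertex set the supremum defining `m_T` is a maximum. -/
theorem bddAbove_maxRemovableLeaves {V : Type*} [Fintype V] (T : SimpleGraph V) :
    BddAbove {m : ℕ | ∃ U : Finset V, IsRemovable T U ∧ U.card = m} := by
  refine ⟨Fintype.card V, ?_⟩
  rintro m ⟨U, -, rfl⟩
  exact Finset.card_le_univ U

/-- On a finite vertex set the supremum defining `w^k(G)` is a maximum (if the set is nonempty). -/
theorem bddAbove_labeledPackingNumber {V : Type*} [Fintype V] (G : SimpleGraph V) (k : ℕ) :
    BddAbove {p : ℕ | 0 < p ∧ ∃ f : V → Fin p, IsLabeledPacking G k p f} := by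
  refine ⟨Fintype.card V, ?_⟩
  rintro p ⟨-, f, hf, -⟩
  simpa using Fintype.card_le_of_surjective f hf

end LabeledPacking

/-! Remove a largest removable set `U` of leaves. The non-star tree `H` that remains has a
fixed-point-free 2-placement into its fifth power moving every vertex by at most 3
(`IsNonStarTree.exists_perm`). Extend it by the identity on `U`. An edge from a leaf in `U` to `y`
is sent to a pair at distance at most 1 + 3, not an edge because `y` moves and the leaf has no other
neighbour. Private labels on `U` and one common label on `H` give `U.card + 1` labels.

To place `H`, root it at a leaf `r`. As `H` is not a star, some path `r, u, v, w` descends to depth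
3. The branches hanging off this path are packed from the bottom up, leaving under each vertex one
unpacked leg of at most three vertices (`packable_below`): two nonempty legs under one vertex are
packed together, and a leg reaching four vertices is packed alone. The path with its three leftover
legs is one of 64 small trees, packed by explicit cycles. `IsLocalPacking` is chosen so that pieces
glue (`IsLocalPacking.union`). -/

namespace LabeledPacking

/-! ### Rooted trees and the gluing of local packings -/

/-- `par` is the parent map of the tree `T` rooted at `r`; the root is its own parent. -/
structure IsParentMap {V : Type*} (T : SimpleGraph V) (r : V) (par : V → V) : Prop where
  par_root : par r = r
  adj : ∀ x, x ≠ r → T.Adj x (par x)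
  adj_cases : ∀ x y, T.Adj x y → (x ≠ r ∧ par x = y) ∨ (y ≠ r ∧ par y = x)
  depth : ∀ x, x ≠ r → T.dist r (par x) + 1 = T.dist r x

namespace IsParentMap

variable {V : Type*} {T : SimpleGraph V} {r : V} {par : V → V}

lemma dist_par (hP : IsParentMap T r par) (x : V) : T.dist r (par x) = T.dist r x - 1 := by
  by_cases hx : x = r
  · subst hx; simp [hP.par_root]
  · have := hP.depth x hx; omega

lemma dist_iterate (hP : IsParentMap T r par) (k : ℕ) (x : V) :
    T.dist r (par^[k] x) = T.dist r x - k := by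
  induction k with
  | zero => simp
  | succ k ih => rw [Function.iterate_succ_apply', hP.dist_par, ih]; omega

lemma ne_root_of_pos {x : V} (hx : 0 < T.dist r x) : x ≠ r := by
  rintro rfl; simp at hx

lemma edist_par (hP : IsParentMap T r par) (x : V) : T.edist x (par x) ≤ 1 := by
  rw [SimpleGraph.edist_le_one_iff_adj_or_eq]
  by_cases hx : x = r
  · right; rw [hx, hP.par_root]
  · exact Or.inl (hP.adj x hx)

end IsParentMap

/-- `τ` maps `S` to itself without fixed points, moves every vertex by at most `3`, and packs the
edges inside `S` and those from `S` to parents outside `S` into the fifth power. -/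
structure IsLocalPacking {V : Type*} (T : SimpleGraph V) (r : V) (par : V → V) (S : Set V)
    (τ : V → V) : Prop where
  mapsTo : ∀ x ∈ S, τ x ∈ S
  injOn : Set.InjOn τ S
  ne : ∀ x ∈ S, τ x ≠ x
  close : ∀ x ∈ S, T.edist x (τ x) ≤ 3
  inner_not_adj : ∀ x ∈ S, x ≠ r → par x ∈ S → ¬ T.Adj (τ x) (τ (par x))
  inner_close : ∀ x ∈ S, x ≠ r → par x ∈ S → T.edist (τ x) (τ (par x)) ≤ 5
  outer_close : ∀ x ∈ S, x ≠ r → par x ∉ S → T.edist (par x) (τ x) ≤ 2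
  outer_par : ∀ x ∈ S, x ≠ r → par x ∉ S → par (τ x) = par x ∨ par (τ x) ∈ S

/-- `S` contains the children of its members. -/
def IsDownClosed {V : Type*} (r : V) (par : V → V) (S : Set V) : Prop :=
  ∀ x, x ≠ r → par x ∈ S → x ∈ S

lemma IsDownClosed.union {V : Type*} {r : V} {par : V → V} {S S' : Set V}
    (h : IsDownClosed r par S) (h' : IsDownClosed r par S') : IsDownClosed r par (S ∪ S') :=
  fun x hx hxS => hxS.elim (fun hs => Or.inl (h x hx hs)) fun hs => Or.inr (h' x hx hs)

lemma isLocalPacking_empty {V : Type*} (T : SimpleGraph V) (r : V) (par : V → V) (τ : V → V) :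
    IsLocalPacking T r par ∅ τ := by
  constructor <;> simp

-- As `G` is down-closed, the only new edges join some `x ∈ G` to `par x ∈ S`. Their images are
-- within 2 + 3 = 5, by `outer_close` and `close`. If the images were adjacent, one would be the
-- parent of the other: `outer_par`, disjointness and `τ'` having no fixed point exclude one
-- direction, down-closedness of `G` the other.
open Classical in
lemma IsLocalPacking.union {V : Type*} {T : SimpleGraph V} {r : V} {par : V → V}
    (hP : IsParentMap T r par) {G S : Set V} {τ τ' : V → V} (hG : IsLocalPacking T r par G τ)
    (hd : IsDownClosed r par G) (hS : IsLocalPacking T r par S τ') (hdisj : Disjoint G S) :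
    IsLocalPacking T r par (G ∪ S) (G.piecewise τ τ') := by
  have e1 : ∀ x ∈ G, G.piecewise τ τ' x = τ x := fun x hx => Set.piecewise_eq_of_mem _ _ _ hx
  have hn : ∀ x ∈ S, x ∉ G := fun x hx hx' => Set.disjoint_left.1 hdisj hx' hx
  have e2 : ∀ x ∈ S, G.piecewise τ τ' x = τ' x := fun x hx =>
    Set.piecewise_eq_of_notMem _ _ _ (hn x hx)
  refine ⟨?_, ?_, ?_, ?_, ?_, ?_, ?_, ?_⟩
  · rintro x (hx | hx)
    · rw [e1 x hx]; exact Or.inl (hG.mapsTo x hx)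
    · rw [e2 x hx]; exact Or.inr (hS.mapsTo x hx)
  · rintro x (hx | hx) y (hy | hy) hxy
    · rw [e1 x hx, e1 y hy] at hxy; exact hG.injOn hx hy hxy
    · rw [e1 x hx, e2 y hy] at hxy
      exact absurd (hxy ▸ hG.mapsTo x hx) (hn _ (hS.mapsTo y hy))
    · rw [e2 x hx, e1 y hy] at hxy
      exact absurd (hxy ▸ hG.mapsTo y hy) (hn _ (hS.mapsTo x hx))
    · rw [e2 x hx, e2 y hy] at hxy; exact hS.injOn hx hy hxy
  · rintro x (hx | hx)
    · rw [e1 x hx]; exact hG.ne x hx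
    · rw [e2 x hx]; exact hS.ne x hx
  · rintro x (hx | hx)
    · rw [e1 x hx]; exact hG.close x hx
    · rw [e2 x hx]; exact hS.close x hx
  · rintro x (hx | hx) hxr (hp | hp)
    · rw [e1 x hx, e1 _ hp]; exact hG.inner_not_adj x hx hxr hp
    · rw [e1 x hx, e2 _ hp]
      intro hadj
      rcases hP.adj_cases _ _ hadj with ⟨-, h⟩ | ⟨hr, h⟩
      · rcases hG.outer_par x hx hxr (hn _ hp) with h' | h'
        · exact hS.ne _ hp (h.symm.trans h')
        · exact hn _ (hS.mapsTo _ hp) (h ▸ h')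
      · exact hn _ (hS.mapsTo _ hp) (hd _ hr (h ▸ hG.mapsTo x hx))
    · exact absurd (hd x hxr hp) (hn x hx)
    · rw [e2 x hx, e2 _ hp]; exact hS.inner_not_adj x hx hxr hp
  · rintro x (hx | hx) hxr (hp | hp)
    · rw [e1 x hx, e1 _ hp]; exact hG.inner_close x hx hxr hp
    · rw [e1 x hx, e2 _ hp]
      calc T.edist (τ x) (τ' (par x)) ≤ T.edist (τ x) (par x) + T.edist (par x) (τ' (par x)) :=
            T.edist_triangle
        _ ≤ 2 + 3 := by
            rw [T.edist_comm (u := τ x)]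
            exact add_le_add (hG.outer_close x hx hxr (hn _ hp)) (hS.close _ hp)
        _ = 5 := by norm_num
    · exact absurd (hd x hxr hp) (hn x hx)
    · rw [e2 x hx, e2 _ hp]; exact hS.inner_close x hx hxr hp
  · rintro x (hx | hx) hxr hp
    · rw [e1 x hx]; exact hG.outer_close x hx hxr fun h => hp (Or.inl h)
    · rw [e2 x hx]; exact hS.outer_close x hx hxr fun h => hp (Or.inr h)
  · rintro x (hx | hx) hxr hp
    · rw [e1 x hx]
      exact (hG.outer_par x hx hxr fun h => hp (Or.inl h)).imp_right Or.inl
    · rw [e2 x hx]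
      exact (hS.outer_par x hx hxr fun h => hp (Or.inr h)).imp_right Or.inr

/-! ### Finite models on initial segments of `ℕ`, checkable by computation -/

/-- In the tree on an initial segment of `ℕ` with parent map `p`, the vertices `i` and `j` are at
distance at most `k`. -/
def Near (p : ℕ → ℕ) (k i j : ℕ) : Prop :=
  ∃ a < k + 1, ∃ b < k + 1 - a, p^[a] i = p^[b] j

instance (p : ℕ → ℕ) (k i j : ℕ) : Decidable (Near p k i j) :=
  inferInstanceAs (Decidable (∃ a < k + 1, ∃ b < k + 1 - a, p^[a] i = p^[b] j))

/-- The vertex `i` satisfies the conditions of a local packing `π` of the vertices `lo ≤ i < n` in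
the tree on `{0, …, n - 1}` with root `0` and parent map `p`. -/
def IsModelAt (n : ℕ) (p π : ℕ → ℕ) (lo i : ℕ) : Prop :=
  lo ≤ π i ∧ π i < n ∧ π i ≠ i ∧ Near p 3 i (π i) ∧
    (i = 0 ∨ (lo ≤ p i ∧ p (π i) ≠ π (p i) ∧ p (π (p i)) ≠ π i ∧ Near p 5 (π i) (π (p i))) ∨
      (p i < lo ∧ Near p 2 (p i) (π i)))

instance (n : ℕ) (p π : ℕ → ℕ) (lo i : ℕ) : Decidable (IsModelAt n p π lo i) := by
  unfold IsModelAt; infer_instance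

/-- `π` is a local packing of the vertices `lo ≤ i < n` in the tree on `{0, …, n - 1}` with root `0`
and parent map `p`. -/
def IsModel (n : ℕ) (p π : ℕ → ℕ) (lo : ℕ) : Prop :=
  (∀ i < n, ∀ j < n, lo ≤ i ∧ lo ≤ j ∧ π i = π j → i = j) ∧
  ∀ i < n, lo ≤ i → IsModelAt n p π lo i

instance (n : ℕ) (p π : ℕ → ℕ) (lo : ℕ) : Decidable (IsModel n p π lo) := by
  unfold IsModel; infer_instance

section Embedding

variable {V : Type*} {T : SimpleGraph V} {r : V} {par : V → V} {e : ℕ → V} {n : ℕ} {p : ℕ → ℕ}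

lemma edist_model_iterate (hP : IsParentMap T r par) (hp0 : p 0 = 0) (hp : ∀ i < n, p i < n)
    (he : ∀ i < n, i ≠ 0 → par (e i) = e (p i)) (a : ℕ) {i : ℕ} (hi : i < n) :
    p^[a] i < n ∧ T.edist (e i) (e (p^[a] i)) ≤ a := by
  induction a with
  | zero => simp [hi]
  | succ a ih =>
    rw [Function.iterate_succ_apply']
    refine ⟨hp _ ih.1, ?_⟩
    have h1 : T.edist (e (p^[a] i)) (e (p (p^[a] i))) ≤ 1 := by
      by_cases h0 : p^[a] i = 0
      · rw [h0, hp0, T.edist_self]; exact zero_le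
      · rw [← he _ ih.1 h0]; exact hP.edist_par _
    calc T.edist (e i) (e (p (p^[a] i)))
        ≤ T.edist (e i) (e (p^[a] i)) + T.edist (e (p^[a] i)) (e (p (p^[a] i))) :=
          T.edist_triangle
      _ ≤ a + 1 := add_le_add ih.2 h1
      _ = ((a + 1 : ℕ) : ℕ∞) := by push_cast; rfl

lemma Near.edist_le (hP : IsParentMap T r par) (hp0 : p 0 = 0) (hp : ∀ i < n, p i < n)
    (he : ∀ i < n, i ≠ 0 → par (e i) = e (p i)) {k i j : ℕ} (hi : i < n) (hj : j < n)
    (h : Near p k i j) : T.edist (e i) (e j) ≤ k := by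
  obtain ⟨a, ha, b, hb, hab⟩ := h
  calc T.edist (e i) (e j) ≤ T.edist (e i) (e (p^[a] i)) + T.edist (e (p^[a] i)) (e j) :=
        T.edist_triangle
    _ ≤ a + b := by
        refine add_le_add (edist_model_iterate hP hp0 hp he a hi).2 ?_
        rw [hab, T.edist_comm]
        exact (edist_model_iterate hP hp0 hp he b hj).2
    _ = ((a + b : ℕ) : ℕ∞) := by push_cast; rfl
    _ ≤ k := by exact_mod_cast (by omega)

/-- A model embedded into a rooted tree gives a local packing of its image. -/
lemma exists_isLocalPacking_of_model (hP : IsParentMap T r par) (hp0 : p 0 = 0)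
    (hp : ∀ i < n, p i < n) (he : ∀ i < n, i ≠ 0 → par (e i) = e (p i))
    (hinj : Set.InjOn e {i | i < n}) {lo : ℕ} (hlo : lo ≤ 1)
    (h0 : lo = 0 → e 0 = r) {π : ℕ → ℕ} (hM : IsModel n p π lo) :
    ∃ τ, IsLocalPacking T r par {x | ∃ i < n, lo ≤ i ∧ e i = x} τ := by
  obtain ⟨hπ, hM⟩ := hM
  -- Transport `π` along `e`; the values off the image of `e` play no role.
  have hτ : ∃ τ : V → V, ∀ i < n, τ (e i) = e (π i) :=
    ⟨fun x => e (π (Function.invFunOn e {i | i < n} x)), fun i hi => by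
      have := hinj.leftInvOn_invFunOn (show i ∈ {i | i < n} from hi)
      simp only [this]⟩
  obtain ⟨τ, hτ⟩ := hτ
  have hmem : ∀ i < n, (e i ∈ {x | ∃ i < n, lo ≤ i ∧ e i = x} ↔ lo ≤ i) := by
    refine fun i hi => ⟨?_, fun h => ⟨i, hi, h, rfl⟩⟩
    rintro ⟨j, hj, hlj, hij⟩
    rwa [← hinj hj hi hij]
  have hz : ∀ i < n, lo ≤ i → e i ≠ r → i ≠ 0 := by
    rintro i hi hl hr rfl
    exact hr (h0 (by omega))
  have hadj : ∀ i < n, ∀ j < n, lo ≤ i → lo ≤ j → T.Adj (e i) (e j) → p i = j ∨ p j = i := by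
    intro i hi j hj hli hlj h
    rcases hP.adj_cases _ _ h with ⟨hr, h⟩ | ⟨hr, h⟩
    · left; rw [he i hi (hz i hi hli hr)] at h; exact hinj (hp i hi) hj h
    · right; rw [he j hj (hz j hj hlj hr)] at h; exact hinj (hp j hj) hi h
  refine ⟨τ, ⟨?_, ?_, ?_, ?_, ?_, ?_, ?_, ?_⟩⟩
  · rintro _ ⟨i, hi, hl, rfl⟩
    obtain ⟨h1, h2, -⟩ := hM i hi hl
    rw [hτ i hi]; exact ⟨_, h2, h1, rfl⟩
  · rintro _ ⟨i, hi, hl, rfl⟩ _ ⟨j, hj, hlj, rfl⟩ hij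
    rw [hτ i hi, hτ j hj] at hij
    rw [hπ i hi j hj ⟨hl, hlj, hinj (hM i hi hl).2.1 (hM j hj hlj).2.1 hij⟩]
  · rintro _ ⟨i, hi, hl, rfl⟩ h
    obtain ⟨h1, h2, h3, -⟩ := hM i hi hl
    rw [hτ i hi] at h; exact h3 (hinj h2 hi h)
  · rintro _ ⟨i, hi, hl, rfl⟩
    obtain ⟨h1, h2, h3, h4, -⟩ := hM i hi hl
    rw [hτ i hi]; exact h4.edist_le hP hp0 hp he hi h2
  · rintro _ ⟨i, hi, hl, rfl⟩ hr hpar h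
    have hi0 := hz i hi hl hr
    rw [he i hi hi0] at hpar h
    rw [hmem _ (hp i hi)] at hpar
    obtain ⟨h1, h2, h3, h4, h5⟩ := hM i hi hl
    obtain ⟨h6, h7, -⟩ := hM _ (hp i hi) hpar
    rw [hτ i hi, hτ _ (hp i hi)] at h
    have := hadj _ h2 _ h7 h1 h6 h
    omega
  · rintro _ ⟨i, hi, hl, rfl⟩ hr hpar
    have hi0 := hz i hi hl hr
    rw [he i hi hi0] at hpar ⊢
    rw [hmem _ (hp i hi)] at hpar
    obtain ⟨h1, h2, h3, h4, h5⟩ := hM i hi hl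
    obtain ⟨h6, h7, -⟩ := hM _ (hp i hi) hpar
    rw [hτ i hi, hτ _ (hp i hi)]
    rcases h5 with h5 | ⟨-, -, -, h5⟩ | ⟨h5, -⟩
    · exact absurd h5 hi0
    · exact h5.edist_le hP hp0 hp he h2 h7
    · omega
  · rintro _ ⟨i, hi, hl, rfl⟩ hr hpar
    have hi0 := hz i hi hl hr
    rw [he i hi hi0] at hpar ⊢
    rw [hmem _ (hp i hi)] at hpar
    obtain ⟨h1, h2, h3, h4, h5⟩ := hM i hi hl
    rw [hτ i hi]
    rcases h5 with h5 | ⟨h5, -⟩ | ⟨-, h5⟩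
    · exact absurd h5 hi0
    · exact absurd h5 hpar
    · exact h5.edist_le hP hp0 hp he (hp i hi) h2
  · rintro _ ⟨i, hi, hl, rfl⟩ hr hpar
    have hi0 := hz i hi hl hr
    rw [he i hi hi0] at hpar ⊢
    rw [hmem _ (hp i hi)] at hpar
    obtain ⟨h1, h2, -⟩ := hM i hi hl
    rw [hτ i hi, he _ h2 (by omega)]
    by_cases h : lo ≤ p (π i)
    · exact Or.inr ((hmem _ (hp _ h2)).2 h)
    -- Both parents have index below `lo ≤ 1`, so both are vertex 0; this is where `lo ≤ 1` is
    -- needed.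
    · left; congr 1; omega

end Embedding

/-! ### Explicit cycles for the small trees -/

/-- A path `0, …, m - 1` going down from the root, then `a` vertices of a leg attached at `j₁`, then
a leg attached at `j₂`. Truncated subtraction makes 0 its own parent. -/
def branchPar (m j₁ a j₂ i : ℕ) : ℕ :=
  if i < m then i - 1 else if i < m + a then if i = m then j₁ else i - 1
  else if i = m + a then j₂ else i - 1

/-- Cyclic successor in `c`. Vertices missing from `c` get a meaningless value; the lists used below
contain every vertex from `lo` on. -/
def listNext (c : List ℕ) (i : ℕ) : ℕ :=
  c.getD ((c.idxOf i + 1) % c.length) 0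

def legCycle (k l : ℕ) : List ℕ :=
  if l = 0 then [] else if l = 1 then [k] else if l = 2 then [k + 1, k] else [k + 1, k + 2, k]

def spineCycle (l : ℕ) : List ℕ :=
  if l = 1 then [4, 3] else 3 :: legCycle 4 l

/-- Here 0, 1, 2, 3 stand for `r, u, v, w`, and `l`, `a`, `b` are the lengths of the legs below `w`,
`v`, `u`. Without legs the cycle is 0, 2, 3, 1, a packing of the four-vertex path. Each leg is
spliced in right after its attachment vertex, except that a single vertex below `w` comes before
`w`. -/
lemma isModel_base (l : ℕ) (hl : l < 4) (a : ℕ) (ha : a < 4) (b : ℕ) (hb : b < 4) : IsModel (4 + l + a + b) (branchPar (4 + l) 2 a 1)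
    (listNext ([0, 2] ++ legCycle (4 + l) a ++ spineCycle l ++ [1] ++ legCycle (4 + l + a) b)) 0 := by
  revert b a l
  decide +kernel
-- Vertex 0 is the parent outside the packed set. The top vertex 1 goes to 2, within the distance 2
-- of vertex 0 that gluing requires.
lemma isModel_path : IsModel 5 (branchPar 5 0 0 0) (listNext [1, 2, 4, 3]) 1 := by decide +kernel

def pairCycle (s t : ℕ) : List ℕ :=
  if s + t ≤ 3 then if s + t = 2 then [1, 2] else [1, 2, 3] else
  if s = 1 then [1, 3, 4, 2] else if s = 2 then if t = 2 then [1, 2, 3, 4] else [1, 4, 5, 3, 2]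
  else if t = 1 then [1, 4, 2, 3] else if t = 2 then [1, 5, 4, 2, 3] else [1, 5, 6, 4, 2, 3]

/-- A leg of at most three vertices is a star and cannot be packed alone, but two legs under a
common vertex 0 can exchange vertices. The tops 1 and `s + 1` must land at depth at most 2 below 0.
-/
lemma isModel_pair (s : ℕ) (hs : s < 4) (t : ℕ) (ht : t < 4) (h0 : s ≠ 0 ∧ t ≠ 0) :
    IsModel (s + 1 + t + 0) (branchPar (s + 1) 0 t 0) (listNext (pairCycle s t)) 1 := by
  revert s t; decide +kernel
-- Legs, and packing the branches from the bottom up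
/-- The bottom `t` vertices of the path from `q` to the root. -/
def leg {V : Type*} (par : V → V) (q : V) (t : ℕ) : Set V :=
  {x | ∃ i < t, par^[i] q = x}

section Packed

variable {V : Type*} {T : SimpleGraph V} {r : V} {par : V → V}

lemma leg_zero (q : V) : leg par q 0 = ∅ := by simp [leg]

lemma leg_succ (q : V) (t : ℕ) : leg par q (t + 1) = insert (par^[t] q) (leg par q t) := by
  ext x
  simp only [leg, Set.mem_ofPred_eq, Set.mem_insert_iff, Nat.lt_succ_iff_lt_or_eq]
  constructor
  · rintro ⟨i, hi | rfl, rfl⟩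
    exacts [Or.inr ⟨i, hi, rfl⟩, Or.inl rfl]
  · rintro (rfl | ⟨i, hi, rfl⟩)
    exacts [⟨t, Or.inr rfl, rfl⟩, ⟨i, Or.inl hi, rfl⟩]

/-- The vertices of a path with bottom `q` followed by those of two legs with bottoms `q₁`, `q₂`,
each listed from top to bottom. -/
def branchEmb (par : V → V) (m a b : ℕ) (q q₁ q₂ : V) (i : ℕ) : V :=
  if i < m then par^[m - 1 - i] q else if i < m + a then par^[m + a - 1 - i] q₁
  else par^[m + a + b - 1 - i] q₂

lemma IsParentMap.iterate_inj (hP : IsParentMap T r par) {q : V} {i j : ℕ}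
    (hi : i ≤ T.dist r q) (hj : j ≤ T.dist r q) (h : par^[i] q = par^[j] q) : i = j := by
  have h1 := hP.dist_iterate i q
  have h2 := hP.dist_iterate j q
  rw [h] at h1; omega

/-- Two legs attached to a path form a locally packable set if the corresponding model is. -/
lemma exists_isLocalPacking_branch (hP : IsParentMap T r par) {m a b j₁ j₂ : ℕ} {q q₁ q₂ : V}
    (hj₁ : j₁ < m) (hj₂ : j₂ < m) (h₁ : par^[a] q₁ = par^[m - 1 - j₁] q)
    (h₂ : par^[b] q₂ = par^[m - 1 - j₂] q) (hq : m ≤ T.dist r q + 1) (hq₁ : a ≤ T.dist r q₁)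
    (hq₂ : b ≤ T.dist r q₂) (hd₁ : ∀ i < m, ∀ j < a, par^[i] q ≠ par^[j] q₁)
    (hd₂ : ∀ i < m, ∀ j < b, par^[i] q ≠ par^[j] q₂)
    (hd₃ : ∀ i < a, ∀ j < b, par^[i] q₁ ≠ par^[j] q₂) {lo : ℕ} (hlo : lo ≤ 1)
    (h0 : lo = 0 → par^[m - 1] q = r) {π : ℕ → ℕ}
    (hM : IsModel (m + a + b) (branchPar m j₁ a j₂) π lo) :
    ∃ τ, IsLocalPacking T r par (leg par q (m - lo) ∪ leg par q₁ a ∪ leg par q₂ b) τ := by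
  have hmodel := exists_isLocalPacking_of_model (e := branchEmb par m a b q q₁ q₂) hP
    (p := branchPar m j₁ a j₂) (n := m + a + b) ?_ ?_ ?_ ?_ hlo ?_ hM
  · suffices hset : leg par q (m - lo) ∪ leg par q₁ a ∪ leg par q₂ b =
        {x | ∃ i < m + a + b, lo ≤ i ∧ branchEmb par m a b q q₁ q₂ i = x} by rwa [hset]
    ext x
    simp only [leg, Set.mem_union, Set.mem_ofPred_eq]
    constructor
    · rintro ((⟨i, hi, rfl⟩ | ⟨i, hi, rfl⟩) | ⟨i, hi, rfl⟩)
      · refine ⟨m - 1 - i, by omega, by omega, ?_⟩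
        rw [branchEmb, if_pos (by omega)]
        congr 2; omega
      · refine ⟨m + a - 1 - i, by omega, by omega, ?_⟩
        rw [branchEmb, if_neg (by omega), if_pos (by omega)]
        congr 2; omega
      · refine ⟨m + a + b - 1 - i, by omega, by omega, ?_⟩
        rw [branchEmb, if_neg (by omega), if_neg (by omega)]
        congr 2; omega
    · rintro ⟨i, hi, hl, rfl⟩
      unfold branchEmb
      split_ifs
      · exact Or.inl (Or.inl ⟨m - 1 - i, by omega, rfl⟩)
      · exact Or.inl (Or.inr ⟨m + a - 1 - i, by omega, rfl⟩)
      · exact Or.inr ⟨m + a + b - 1 - i, by omega, rfl⟩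
  · simp only [branchPar]; rw [if_pos (by omega)]
  · intro i hi
    unfold branchPar
    split_ifs <;> omega
  · intro i hi hi0
    unfold branchPar branchEmb
    by_cases c1 : i < m
    · rw [if_pos c1, if_pos c1, if_pos (by omega), ← Function.iterate_succ_apply' par]
      congr 2; omega
    rw [if_neg c1, if_neg c1]
    by_cases c2 : i < m + a
    · rw [if_pos c2, if_pos c2, ← Function.iterate_succ_apply' par]
      by_cases c3 : i = m
      · rw [if_pos c3, if_pos hj₁, ← h₁]
        congr 2; omega
      · rw [if_neg c3, if_neg (by omega), if_pos (by omega)]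
        congr 2; omega
    · rw [if_neg c2, if_neg c2, ← Function.iterate_succ_apply' par]
      by_cases c3 : i = m + a
      · rw [if_pos c3, if_pos hj₂, ← h₂]
        congr 2; omega
      · rw [if_neg c3, if_neg (by omega), if_neg (by omega)]
        congr 2; omega
  · intro i hi j hj hij
    simp only [Set.mem_ofPred_eq] at hi hj
    unfold branchEmb at hij
    split_ifs at hij
    · have := hP.iterate_inj (by omega) (by omega) hij; omega
    · exact absurd hij (hd₁ _ (by omega) _ (by omega))
    · exact absurd hij (hd₂ _ (by omega) _ (by omega))
    · exact absurd hij.symm (hd₁ _ (by omega) _ (by omega))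
    · have := hP.iterate_inj (by omega) (by omega) hij; omega
    · exact absurd hij (hd₃ _ (by omega) _ (by omega))
    · exact absurd hij.symm (hd₂ _ (by omega) _ (by omega))
    · exact absurd hij.symm (hd₃ _ (by omega) _ (by omega))
    · have := hP.iterate_inj (by omega) (by omega) hij; omega
  · intro hl
    rw [branchEmb, if_pos (by omega), Nat.sub_zero, h0 hl]

/-- The set `D` of vertices strictly below `v` is the union of a locally packed down-closed set
and a path of length less than `4` that ends just below `v`. -/
structure IsPacked (T : SimpleGraph V) (r : V) (par : V → V) (v : V) (D : Set V) (t : ℕ) (q : V)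
    (G : Set V) (τ : V → V) : Prop where
  lt : t < 4
  top : par^[t] q = v
  depth : T.dist r q = T.dist r v + t
  eq_union : D = G ∪ leg par q t
  disj : Disjoint G (leg par q t)
  packing : IsLocalPacking T r par G τ
  downClosed : IsDownClosed r par G

/-- `D` can be packed up to a short path that ends just below `v`. -/
def Packable (T : SimpleGraph V) (r : V) (par : V → V) (v : V) (D : Set V) : Prop :=
  IsDownClosed r par D ∧ ∃ t q G τ, IsPacked T r par v D t q G τ

lemma Packable.of_isLocalPacking {v : V} {D : Set V} (hd : IsDownClosed r par D) {τ : V → V}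
    (h : IsLocalPacking T r par D τ) : Packable T r par v D :=
  ⟨hd, 0, v, D, τ, by norm_num, rfl, rfl, by simp [leg_zero], by simp [leg_zero], h, hd⟩

lemma Packable.empty (v : V) : Packable T r par v ∅ :=
  .of_isLocalPacking (fun _ _ h => h.elim) (isLocalPacking_empty T r par id)

lemma Packable.union (hP : IsParentMap T r par) {v : V} {D₁ D₂ : Set V}
    (h₁ : Packable T r par v D₁) (h₂ : Packable T r par v D₂) (hdisj : Disjoint D₁ D₂) :
    Packable T r par v (D₁ ∪ D₂) := by
  obtain ⟨hd₁, t₁, q₁, G₁, τ₁, k₁⟩ := h₁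
  obtain ⟨hd₂, t₂, q₂, G₂, τ₂, k₂⟩ := h₂
  have e₁ := k₁.eq_union
  have e₂ := k₂.eq_union
  have hd := hd₁.union hd₂
  rw [e₁, e₂, Set.disjoint_union_left, Set.disjoint_union_right, Set.disjoint_union_right] at hdisj
  obtain ⟨⟨hGG, hGl⟩, hlG, hll⟩ := hdisj
  have hG := k₁.packing.union hP k₁.downClosed k₂.packing hGG
  have hGd := k₁.downClosed.union k₂.downClosed
  rcases Nat.eq_zero_or_pos t₁ with rfl | ht₁
  · refine ⟨hd, t₂, q₂, G₁ ∪ G₂, _, k₂.lt, k₂.top, k₂.depth, ?_, ?_, hG, hGd⟩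
    · rw [e₁, e₂, leg_zero, Set.union_empty, Set.union_assoc]
    · exact Set.disjoint_union_left.2 ⟨hGl, k₂.disj⟩
  rcases Nat.eq_zero_or_pos t₂ with rfl | ht₂
  · refine ⟨hd, t₁, q₁, G₁ ∪ G₂, _, k₁.lt, k₁.top, k₁.depth, ?_, ?_, hG, hGd⟩
    · rw [e₁, e₂, leg_zero, Set.union_empty, Set.union_right_comm]
    · exact Set.disjoint_union_left.2 ⟨k₁.disj, hlG.symm⟩
  have hlegs : ∀ i < t₁, ∀ j < t₂, par^[i] q₁ ≠ par^[j] q₂ := fun i hi j hj h =>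
    Set.disjoint_left.1 hll ⟨i, hi, rfl⟩ ⟨j, hj, h.symm⟩
  have hD₁ := k₁.depth
  have hD₂ := k₂.depth
  -- The model path consists of `v` and the first leg; `lo = 1` leaves `v` out of the packed set.
  -- The third leg is empty.
  obtain ⟨τ, hτ⟩ := exists_isLocalPacking_branch hP (m := t₁ + 1) (a := t₂) (b := 0) (j₁ := 0)
    (j₂ := 0) (q := q₁) (q₁ := q₂) (q₂ := v) (by omega) (by omega)
    (by simp [k₁.top, k₂.top]) (by simp [k₁.top]) (by omega) (by omega) (by omega)
    (by
      intro i hi j hj h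
      rcases Nat.lt_succ_iff_lt_or_eq.1 hi with hi | rfl
      · exact hlegs i hi j hj h
      · rw [k₁.top] at h
        have := hP.dist_iterate j q₂
        rw [← h] at this; omega)
    (by omega) (by omega) le_rfl (by omega)
    (isModel_pair t₁ k₁.lt t₂ k₂.lt ⟨by omega, by omega⟩)
  rw [leg_zero, Set.union_empty, Nat.add_sub_cancel] at hτ
  have huni := hG.union hP hGd hτ (by
    rw [Set.disjoint_union_left, Set.disjoint_union_right, Set.disjoint_union_right]
    exact ⟨⟨k₁.disj, hGl⟩, hlG.symm, k₂.disj⟩)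
  have hset : G₁ ∪ G₂ ∪ (leg par q₁ t₁ ∪ leg par q₂ t₂) = D₁ ∪ D₂ := by
    rw [e₁, e₂, Set.union_union_union_comm]
  rw [hset] at huni
  exact .of_isLocalPacking hd huni

lemma Packable.lift (hP : IsParentMap T r par) {c : V} {D : Set V} (hc : c ≠ r)
    (h : Packable T r par c D) (hcD : c ∉ D) (hd : IsDownClosed r par (insert c D)) :
    Packable T r par (par c) (insert c D) := by
  obtain ⟨-, t, q, G, τ, k⟩ := h
  have e := k.eq_union
  have hdep := k.depth
  have hc' := hP.depth c hc
  have hlt := k.lt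
  have htop : par^[t + 1] q = par c := by rw [Function.iterate_succ_apply', k.top]
  have huni : insert c D = G ∪ leg par q (t + 1) := by
    rw [e, leg_succ, k.top, Set.union_insert]
  have hdisj : Disjoint G (leg par q (t + 1)) := by
    rw [leg_succ, k.top, Set.disjoint_insert_right]
    exact ⟨fun h => hcD (e ▸ Or.inl h), k.disj⟩
  by_cases ht : t + 1 < 4
  · exact ⟨hd, t + 1, q, G, τ, ht, htop, by omega, huni, hdisj, k.packing, k.downClosed⟩
  obtain rfl : t = 3 := by omega
  -- With `c` the leg has four vertices and is packed alone; the fifth vertex of the model is `par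
  -- c`, left out by `lo = 1`.
  obtain ⟨τ', hτ'⟩ := exists_isLocalPacking_branch hP (m := 5) (a := 0) (b := 0) (j₁ := 0)
    (j₂ := 0) (q := q) (q₁ := par c) (q₂ := par c) (by omega) (by omega)
    (by simpa using htop.symm) (by simpa using htop.symm) (by omega) (by omega) (by omega)
    (by omega) (by omega) (by omega) le_rfl (by omega) isModel_path
  rw [leg_zero, Set.union_empty, Set.union_empty] at hτ'
  have := k.packing.union hP k.downClosed hτ' hdisj
  rw [← huni] at this
  exact .of_isLocalPacking hd this

/-! ### Ancestors and the branches below a set of children -/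

/-- The vertex `c` is a weak ancestor of `x`. -/
def IsAncestor (T : SimpleGraph V) (r : V) (par : V → V) (c x : V) : Prop :=
  ∃ k, par^[k] x = c ∧ T.dist r x = T.dist r c + k

lemma IsAncestor.refl (c : V) : IsAncestor T r par c c := ⟨0, rfl, rfl⟩

lemma IsAncestor.unique {c c' x : V} (h : IsAncestor T r par c x) (h' : IsAncestor T r par c' x)
    (he : T.dist r c = T.dist r c') : c = c' := by
  obtain ⟨k, hk, e⟩ := h
  obtain ⟨k', hk', e'⟩ := h'
  obtain rfl : k = k' := by omega
  exact hk.symm.trans hk'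

lemma IsAncestor.of_par (hP : IsParentMap T r par) {c x : V} (hx : x ≠ r)
    (h : IsAncestor T r par c (par x)) : IsAncestor T r par c x := by
  obtain ⟨k, hk, e⟩ := h
  exact ⟨k + 1, by rwa [Function.iterate_succ_apply], by have := hP.depth x hx; omega⟩

lemma IsAncestor.map_par (hP : IsParentMap T r par) {c x : V} (hc : c ≠ r)
    (h : IsAncestor T r par c x) : IsAncestor T r par (par c) x := by
  obtain ⟨k, hk, e⟩ := h
  exact ⟨k + 1, by rw [Function.iterate_succ_apply', hk], by have := hP.depth c hc; omega⟩

lemma IsAncestor.dist_le {c x : V} (h : IsAncestor T r par c x) : T.dist r c ≤ T.dist r x := by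
  obtain ⟨k, -, e⟩ := h; omega

/-- The vertices below a member of `C`, including the members of `C`. -/
def below (T : SimpleGraph V) (r : V) (par : V → V) (C : Set V) : Set V :=
  {x | ∃ c ∈ C, IsAncestor T r par c x}

lemma isDownClosed_below (hP : IsParentMap T r par) (C : Set V) :
    IsDownClosed r par (below T r par C) := by
  rintro x hx ⟨c, hc, h⟩
  exact ⟨c, hc, h.of_par hP hx⟩

lemma below_singleton (hP : IsParentMap T r par) {c : V} :
    below T r par {c} = insert c (below T r par {x | x ≠ r ∧ par x = c}) := by
  ext x
  simp only [below, Set.mem_ofPred_eq, Set.mem_singleton_iff, exists_eq_left, Set.mem_insert_iff]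
  constructor
  · rintro ⟨k, hk, e⟩
    cases k with
    | zero => exact Or.inl hk
    | succ k =>
      have hd := hP.dist_iterate k x
      have hne : par^[k] x ≠ r := IsParentMap.ne_root_of_pos (T := T) (by omega)
      exact Or.inr ⟨par^[k] x, ⟨hne, by rwa [← Function.iterate_succ_apply' par]⟩,
        k, rfl, by omega⟩
  · rintro (rfl | ⟨d, ⟨hd, rfl⟩, h⟩)
    · exact .refl x
    · exact h.map_par hP hd

/-- The vertices below a set of children of `v` are packable. -/
lemma packable_below [Fintype V] (hP : IsParentMap T r par) (v : V) (C : Set V)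
    (hC : ∀ c ∈ C, c ≠ r ∧ par c = v) : Packable T r par v (below T r par C) := by
  obtain ⟨N, hN⟩ : ∃ N, ∀ x, T.dist r x ≤ N :=
    ⟨Finset.univ.sup (T.dist r), fun x => Finset.le_sup (Finset.mem_univ x)⟩
  -- `k` bounds the height left below `v`; it drops by one at each child. The inner induction adds
  -- the children one by one.
  obtain ⟨k, hk⟩ : ∃ k, N < T.dist r v + k := ⟨N + 1, by omega⟩
  induction k generalizing v C with
  | zero => have := hN v; omega
  | succ k ih =>
    induction C, C.toFinite using Set.Finite.induction_on with
    | empty => simpa [below] using Packable.empty v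
    | @insert c C hcC _ ihC =>
      obtain ⟨hcr, rfl⟩ := hC c (Set.mem_insert _ _)
      have hCs : ∀ d ∈ C, d ≠ r ∧ par d = par c := fun d hd => hC d (Set.mem_insert_of_mem _ hd)
      have hdc := hP.depth c hcr
      have hun : below T r par (insert c C) = below T r par {c} ∪ below T r par C := by
        ext x; simp [below]
      rw [hun]
      refine Packable.union hP ?_ (ihC hCs) ?_
      · have hdown := isDownClosed_below hP {c}
        rw [below_singleton hP] at hdown ⊢
        refine Packable.lift hP hcr (ih c _ (fun d hd => hd) (by omega)) ?_ hdown
        rintro ⟨d, ⟨hdr, hd⟩, h⟩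
        have h1 := h.dist_le
        have h2 := hP.depth d hdr
        rw [hd] at h2; omega
      · rw [Set.disjoint_left]
        rintro x ⟨c', rfl, h⟩ ⟨d, hd, h'⟩
        obtain ⟨hdr, hdp⟩ := hCs d hd
        have h2 := hP.depth d hdr
        rw [hdp] at h2
        exact hcC (h.unique h' (by omega) ▸ hd)

/-! ### Packing a whole non-star tree -/

/-- A tree rooted at a leaf with a vertex at distance at least `3` from the root is locally
packable as a whole. -/
lemma exists_isLocalPacking_univ [Fintype V] (hP : IsParentMap T r par)
    (hleaf : ∀ x y, T.Adj r x → T.Adj r y → x = y) {w : V} (hw : T.dist r w = 3) :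
    ∃ τ, IsLocalPacking T r par Set.univ τ := by
  have hd1 := hP.dist_iterate 1 w
  have hd2 := hP.dist_iterate 2 w
  have hd3 := hP.dist_iterate 3 w
  have hdr : T.dist r r = 0 := SimpleGraph.dist_self
  have hroot : ∀ x, T.dist r x = 0 → x = r := by
    intro x hx; by_contra h; have := hP.depth x h; omega
  have hr3 : par^[3] w = r := hroot _ (by omega)
  obtain ⟨v, hv⟩ : ∃ v, v = par w := ⟨_, rfl⟩
  obtain ⟨u, hu⟩ : ∃ u, u = par v := ⟨_, rfl⟩
  have hur : par u = r := by rw [hu, hv]; exact hr3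
  have hdv : T.dist r v = 2 := by rw [hv]; simpa [hw] using hd1
  have hdu : T.dist r u = 1 := by rw [hu, hv]; simpa [hw] using hd2
  have hwr : w ≠ r := IsParentMap.ne_root_of_pos (T := T) (by omega)
  have hvr : v ≠ r := IsParentMap.ne_root_of_pos (T := T) (by omega)
  have hur' : u ≠ r := IsParentMap.ne_root_of_pos (T := T) (by omega)
  have hp1 := packable_below hP w {x | x ≠ r ∧ par x = w} fun c hc => hc
  have hp2 := packable_below hP v {x | x ≠ r ∧ par x = v ∧ x ≠ w} fun c hc => ⟨hc.1, hc.2.1⟩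
  have hp3 := packable_below hP u {x | x ≠ r ∧ par x = u ∧ x ≠ v} fun c hc => ⟨hc.1, hc.2.1⟩
  obtain ⟨D₁, hD₁⟩ : ∃ D, D = below T r par {x | x ≠ r ∧ par x = w} := ⟨_, rfl⟩
  obtain ⟨D₂, hD₂⟩ : ∃ D, D = below T r par {x | x ≠ r ∧ par x = v ∧ x ≠ w} := ⟨_, rfl⟩
  obtain ⟨D₃, hD₃⟩ : ∃ D, D = below T r par {x | x ≠ r ∧ par x = u ∧ x ≠ v} := ⟨_, rfl⟩
  rw [← hD₁] at hp1
  rw [← hD₂] at hp2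
  rw [← hD₃] at hp3
  have m₁ : ∀ x ∈ D₁, 4 ≤ T.dist r x ∧ IsAncestor T r par w x ∧ IsAncestor T r par v x := by
    rw [hD₁]; rintro x ⟨c, ⟨hc, hcw⟩, h⟩
    have := hP.depth c hc
    have h1 := h.dist_le
    have h2 : IsAncestor T r par w x := hcw ▸ h.map_par hP hc
    rw [hcw] at this
    exact ⟨by omega, h2, hv ▸ h2.map_par hP hwr⟩
  have m₂ : ∀ x ∈ D₂, 3 ≤ T.dist r x ∧ ¬ IsAncestor T r par w x ∧ IsAncestor T r par v x := by
    rw [hD₂]; rintro x ⟨c, ⟨hc, hcv, hcw⟩, h⟩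
    have := hP.depth c hc
    have h1 := h.dist_le
    rw [hcv] at this
    exact ⟨by omega, fun h' => hcw (h.unique h' (by omega)), hcv ▸ h.map_par hP hc⟩
  have m₃ : ∀ x ∈ D₃, 2 ≤ T.dist r x ∧ ¬ IsAncestor T r par v x := by
    rw [hD₃]; rintro x ⟨c, ⟨hc, hcu, hcv⟩, h⟩
    have := hP.depth c hc
    have h1 := h.dist_le
    rw [hcu] at this
    exact ⟨by omega, fun h' => hcv (h.unique h' (by omega))⟩
  have d₁₂ : Disjoint D₁ D₂ := Set.disjoint_left.2 fun x h h' => (m₂ x h').2.1 (m₁ x h).2.1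
  have d₁₃ : Disjoint D₁ D₃ := Set.disjoint_left.2 fun x h h' => (m₃ x h').2 (m₁ x h).2.2
  have d₂₃ : Disjoint D₂ D₃ := Set.disjoint_left.2 fun x h h' => (m₃ x h').2 (m₂ x h).2.2
  have hvw : IsAncestor T r par v w := ⟨1, hv.symm, by omega⟩
  -- Induction on depth. The root being a leaf enters for children of `r`: the only one is `u`.
  have hall : ∀ n x, T.dist r x = n →
      x = r ∨ x = u ∨ x = v ∨ x = w ∨ x ∈ D₁ ∨ x ∈ D₂ ∨ x ∈ D₃ := by
    intro n
    induction n with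
    | zero => exact fun x hx => Or.inl (hroot x hx)
    | succ n ih =>
      intro x hx
      have hxr : x ≠ r := IsParentMap.ne_root_of_pos (T := T) (by omega)
      have hdx := hP.depth x hxr
      by_cases hxv : x = v
      · simp [hxv]
      by_cases hxw : x = w
      · simp [hxw]
      rcases ih (par x) (by omega) with h | h | h | h | h | h | h
      · right; left
        refine hleaf x u ?_ ?_
        · rw [← h]; exact (hP.adj x hxr).symm
        · nth_rewrite 1 [← hur]; exact (hP.adj u hur').symm
      · have : x ∈ D₃ := by rw [hD₃]; exact ⟨x, ⟨hxr, h, hxv⟩, .refl x⟩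
        simp [this]
      · have : x ∈ D₂ := by rw [hD₂]; exact ⟨x, ⟨hxr, h, hxw⟩, .refl x⟩
        simp [this]
      · have : x ∈ D₁ := by rw [hD₁]; exact ⟨x, ⟨hxr, h⟩, .refl x⟩
        simp [this]
      · have := hp1.1 x hxr h; simp [this]
      · have := hp2.1 x hxr h; simp [this]
      · have := hp3.1 x hxr h; simp [this]
  obtain ⟨-, t₁, q₁, G₁, τ₁, k₁⟩ := hp1
  obtain ⟨-, t₂, q₂, G₂, τ₂, k₂⟩ := hp2
  obtain ⟨-, t₃, q₃, G₃, τ₃, k₃⟩ := hp3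
  have e₁ := k₁.eq_union
  have e₂ := k₂.eq_union
  have e₃ := k₃.eq_union
  have b₁ := k₁.depth
  have b₂ := k₂.depth
  have b₃ := k₃.depth
  -- The leg below `w` prolongs `r, u, v, w` to a single path with bottom `q₁` and `4 + t₁`
  -- vertices.
  have i₀ : ∀ i, par^[t₁ + i] q₁ = par^[i] w := by
    intro i; rw [add_comm, Function.iterate_add_apply, k₁.top]
  have hs : ∀ x ∈ leg par q₁ (4 + t₁),
      x ∈ leg par q₁ t₁ ∨ x = w ∨ x = v ∨ x = u ∨ x = r := by
    rintro x ⟨i, hi, rfl⟩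
    by_cases h : i < t₁
    · exact Or.inl ⟨i, h, rfl⟩
    obtain ⟨j, rfl⟩ := Nat.exists_eq_add_of_le (not_lt.1 h)
    have hj : j < 4 := by omega
    rw [i₀]
    right
    interval_cases j
    · simp
    · right; left; exact hv.symm
    · right; right; left; rw [hu, hv]; rfl
    · right; right; right; exact hr3
  have hw2 : w ∉ D₂ := fun h => (m₂ w h).2.1 (.refl w)
  have hw3 : w ∉ D₃ := fun h => (m₃ w h).2 hvw
  have hw1 : w ∉ D₁ := fun h => by have := (m₁ w h).1; omega
  have hv1 : v ∉ D₁ := fun h => by have := (m₁ v h).1; omega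
  have hv2 : v ∉ D₂ := fun h => by have := (m₂ v h).1; omega
  have hv3 : v ∉ D₃ := fun h => (m₃ v h).2 (.refl v)
  have hu1 : u ∉ D₁ := fun h => by have := (m₁ u h).1; omega
  have hu2 : u ∉ D₂ := fun h => by have := (m₂ u h).1; omega
  have hu3 : u ∉ D₃ := fun h => by have := (m₃ u h).1; omega
  have hr1 : r ∉ D₁ := fun h => by have := (m₁ r h).1; omega
  have hr2 : r ∉ D₂ := fun h => by have := (m₂ r h).1; omega
  have hr3' : r ∉ D₃ := fun h => by have := (m₃ r h).1; omega
  have l₁ : leg par q₁ t₁ ⊆ D₁ := e₁ ▸ Set.subset_union_right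
  have l₂ : leg par q₂ t₂ ⊆ D₂ := e₂ ▸ Set.subset_union_right
  have l₃ : leg par q₃ t₃ ⊆ D₃ := e₃ ▸ Set.subset_union_right
  have g₁ : G₁ ⊆ D₁ := e₁ ▸ Set.subset_union_left
  have g₂ : G₂ ⊆ D₂ := e₂ ▸ Set.subset_union_left
  have g₃ : G₃ ⊆ D₃ := e₃ ▸ Set.subset_union_left
  have s₂ : Disjoint (leg par q₁ (4 + t₁)) D₂ := Set.disjoint_left.2 fun x h h' => by
    rcases hs x h with h | rfl | rfl | rfl | rfl
    · exact Set.disjoint_left.1 d₁₂ (l₁ h) h'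
    all_goals contradiction
  have s₃ : Disjoint (leg par q₁ (4 + t₁)) D₃ := Set.disjoint_left.2 fun x h h' => by
    rcases hs x h with h | rfl | rfl | rfl | rfl
    · exact Set.disjoint_left.1 d₁₃ (l₁ h) h'
    all_goals contradiction
  have s₁ : Disjoint (leg par q₁ (4 + t₁)) G₁ := Set.disjoint_left.2 fun x h h' => by
    rcases hs x h with h | rfl | rfl | rfl | rfl
    · exact Set.disjoint_left.1 k₁.disj h' h
    all_goals have := g₁ h'; contradiction
  -- Counted from the root, `v` has index 2 and `u` index 1.
  obtain ⟨τ, hτ⟩ := exists_isLocalPacking_branch hP (m := 4 + t₁) (a := t₂) (b := t₃) (j₁ := 2)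
    (j₂ := 1) (q := q₁) (q₁ := q₂) (q₂ := q₃) (by omega) (by omega)
    (by
      rw [k₂.top, show 4 + t₁ - 1 - 2 = t₁ + 1 by omega, i₀]; exact hv)
    (by
      rw [k₃.top, show 4 + t₁ - 1 - 1 = t₁ + 2 by omega, i₀, hu, hv]; rfl)
    (by omega) (by omega) (by omega)
    (fun i hi j hj h => Set.disjoint_left.1 s₂ ⟨i, hi, rfl⟩ (l₂ ⟨j, hj, h.symm⟩))
    (fun i hi j hj h => Set.disjoint_left.1 s₃ ⟨i, hi, rfl⟩ (l₃ ⟨j, hj, h.symm⟩))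
    (fun i hi j hj h => Set.disjoint_left.1 d₂₃ (l₂ ⟨i, hi, rfl⟩) (l₃ ⟨j, hj, h.symm⟩))
    zero_le_one
    (fun _ => by rw [show 4 + t₁ - 1 = t₁ + 3 by omega, i₀]; exact hr3)
    (isModel_base t₁ k₁.lt t₂ k₂.lt t₃ k₃.lt)
  have hG₁₂ := k₁.packing.union hP k₁.downClosed k₂.packing (d₁₂.mono g₁ g₂)
  have hG := hG₁₂.union hP (k₁.downClosed.union k₂.downClosed) k₃.packing
    (Set.disjoint_union_left.2 ⟨d₁₃.mono g₁ g₃, d₂₃.mono g₂ g₃⟩)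
  have hfin := hG.union hP ((k₁.downClosed.union k₂.downClosed).union k₃.downClosed) hτ (by
    simp only [Set.disjoint_union_left, Set.disjoint_union_right]
    exact ⟨⟨⟨⟨s₁.symm, s₂.symm.mono_left g₂⟩, s₃.symm.mono_left g₃⟩,
      ⟨d₁₂.mono g₁ l₂, k₂.disj⟩, d₂₃.symm.mono g₃ l₂⟩,
      ⟨d₁₃.mono g₁ l₃, d₂₃.mono g₂ l₃⟩, k₃.disj⟩)
  suffices hset : G₁ ∪ G₂ ∪ G₃ ∪ (leg par q₁ (4 + t₁ - 0) ∪ leg par q₂ t₂ ∪ leg par q₃ t₃) =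
      Set.univ from ⟨_, hset ▸ hfin⟩
  refine Set.eq_univ_of_forall fun x => ?_
  have hmem : ∀ i < 4, par^[i] w ∈ leg par q₁ (4 + t₁ - 0) := fun i hi =>
    ⟨t₁ + i, by omega, i₀ i⟩
  have hsub : ∀ y ∈ leg par q₁ t₁, y ∈ leg par q₁ (4 + t₁ - 0) := by
    rintro _ ⟨i, hi, rfl⟩; exact ⟨i, by omega, rfl⟩
  have c₀ : ∀ y ∈ leg par q₁ (4 + t₁ - 0), y ∈ G₁ ∪ G₂ ∪ G₃ ∪
      (leg par q₁ (4 + t₁ - 0) ∪ leg par q₂ t₂ ∪ leg par q₃ t₃) :=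
    fun y hy => Or.inr (Or.inl (Or.inl hy))
  rcases hall _ x rfl with h | h | h | h | h | h | h
  · rw [h]; exact c₀ _ (hr3 ▸ hmem 3 (by omega))
  · rw [h, hu, hv]; exact c₀ _ (hmem 2 (by omega))
  · rw [h, hv]; exact c₀ _ (hmem 1 (by omega))
  · rw [h]; exact c₀ _ (hmem 0 (by omega))
  · rw [e₁] at h
    rcases h with h | h
    · exact Or.inl (Or.inl (Or.inl h))
    · exact c₀ _ (hsub x h)
  · rw [e₂] at h
    rcases h with h | h
    · exact Or.inl (Or.inl (Or.inr h))
    · exact Or.inr (Or.inl (Or.inr h))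
  · rw [e₃] at h
    rcases h with h | h
    · exact Or.inl (Or.inr h)
    · exact Or.inr (Or.inr h)

end Packed


lemma exists_isParentMap {V : Type*} {T : SimpleGraph V} (hT : T.IsTree) (r : V) :
    ∃ par, IsParentMap T r par := by
  classical
  have hex : ∀ x, x ≠ r → ∃ y, T.Adj x y ∧ T.dist r y + 1 = T.dist r x := by
    intro x hx
    obtain ⟨p, hp⟩ := hT.connected.exists_walk_length_eq_dist x r
    cases p with
    | nil => exact absurd rfl hx
    | @cons _ y _ h p =>
      refine ⟨y, h, ?_⟩
      have h1 := T.dist_le p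
      rw [SimpleGraph.Walk.length_cons] at hp
      have h2 := hT.dist_eq_dist_add_one_of_adj r h
      rw [T.dist_comm (u := x)] at hp
      rw [T.dist_comm (u := y)] at h1
      omega
  -- Two neighbours of `x` nearer to `r` would give two paths from `r` to `x`.
  have huniq : ∀ x y z, T.Adj x y → T.Adj x z → T.dist r y + 1 = T.dist r x →
      T.dist r z + 1 = T.dist r x → y = z := by
    intro x y z hy hz dy dz
    obtain ⟨p, hp⟩ := hT.connected.exists_walk_length_eq_dist r y
    obtain ⟨q, hq⟩ := hT.connected.exists_walk_length_eq_dist r z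
    have hp' := (p.concat hy.symm).isPath_of_length_eq_dist (by
      rw [SimpleGraph.Walk.length_concat]; omega)
    have hq' := (q.concat hz.symm).isPath_of_length_eq_dist (by
      rw [SimpleGraph.Walk.length_concat]; omega)
    have := (hT.existsUnique_path r x).unique hp' hq'
    simpa using congrArg SimpleGraph.Walk.penultimate this
  choose! g hg using hex
  have hpar : ∀ x, x ≠ r → (if x = r then r else g x) = g x := fun x hx => if_neg hx
  refine ⟨fun x => if x = r then r else g x, by simp, ?_, ?_, ?_⟩
  · intro x hx; simp only [hpar x hx]; exact (hg x hx).1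
  · intro x y h
    rcases hT.dist_eq_dist_add_one_of_adj r h with h' | h'
    · have hx : x ≠ r := IsParentMap.ne_root_of_pos (T := T) (by omega)
      left
      simp only [hpar x hx]
      exact ⟨hx, huniq x _ _ (hg x hx).1 h (hg x hx).2 h'.symm⟩
    · have hy : y ≠ r := IsParentMap.ne_root_of_pos (T := T) (by omega)
      right
      simp only [hpar y hy]
      exact ⟨hy, huniq y _ _ (hg y hy).1 h.symm (hg y hy).2 h'.symm⟩
  · intro x hx; simp only [hpar x hx]; exact (hg x hx).2

/-- A vertex deeper than 3 has an ancestor at depth 3. If all depths are at most 2, the only vertex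
at depth 1 is `u`, and every edge has an end at depth 1, so the tree is a star centred at `u`. -/
lemma IsNonStarTree.exists_dist_eq_three {V : Type*} {T : SimpleGraph V} (hT : IsNonStarTree T)
    {r u : V} {par : V → V} (hP : IsParentMap T r par) (hru : T.Adj r u)
    (hleaf : ∀ x, T.Adj r x → x = u) : ∃ w, T.dist r w = 3 := by
  by_contra! hno
  have h2 : ∀ x, T.dist r x ≤ 2 := by
    intro x
    by_contra h
    have := hP.dist_iterate (T.dist r x - 3) x
    exact hno (par^[T.dist r x - 3] x) (by omega)
  have h1 : ∀ x, T.dist r x = 1 → x = u := fun x hx =>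
    hleaf x (SimpleGraph.dist_eq_one_iff_adj.1 hx)
  have h0 : ∀ x, T.dist r x = 0 → x = r := by
    intro x hx; by_contra h; have := hP.depth x h; omega
  have hadj : ∀ y, y ≠ u → T.Adj u y := by
    intro y hy
    by_cases hyr : y = r
    · subst hyr; exact hru.symm
    have hd := hP.depth y hyr
    have := h2 y
    have hy1 : T.dist r y ≠ 1 := fun h => hy (h1 y h)
    rw [← h1 (par y) (by omega)]
    exact (hP.adj y hyr).symm
  refine hT.2 ⟨u, ?_⟩
  ext x y
  rw [SimpleGraph.starGraph_adj]
  constructor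
  · intro h
    refine ⟨h.ne, ?_⟩
    have hx := h2 x
    have hy := h2 y
    rcases hT.1.dist_eq_dist_add_one_of_adj r h with h' | h'
    · by_cases hx1 : T.dist r x = 1
      · exact Or.inl (h1 x hx1)
      · exact Or.inr (h1 y (by omega))
    · by_cases hy1 : T.dist r y = 1
      · exact Or.inr (h1 y hy1)
      · exact Or.inl (h1 x (by omega))
  · rintro ⟨hne, rfl | rfl⟩
    · exact hadj y hne.symm
    · exact (hadj x hne).symm

/-- Every finite non-star tree has a fixed-point-free 2-placement into its fifth power that moves
every vertex by at most `3`. -/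
theorem IsNonStarTree.exists_perm {V : Type*} [Fintype V] {T : SimpleGraph V}
    (hT : IsNonStarTree T) :
    ∃ σ : Equiv.Perm V, (∀ x, σ x ≠ x) ∧ (∀ x, T.edist x (σ x) ≤ 3) ∧
      ∀ x y, T.Adj x y → ¬ T.Adj (σ x) (σ y) ∧ T.edist (σ x) (σ y) ≤ 5 := by
  classical
  have hnt : Nontrivial V := by
    obtain ⟨r⟩ := hT.1.connected.nonempty
    by_contra h
    rw [not_nontrivial_iff_subsingleton] at h
    refine hT.2 ⟨r, ?_⟩
    ext x y
    rw [Subsingleton.elim x y]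
    simp
  obtain ⟨r, hr⟩ := hT.1.exists_vert_degree_one_of_nontrivial
  obtain ⟨u, hru, hleaf⟩ := SimpleGraph.degree_eq_one_iff_existsUnique_adj.1 hr
  obtain ⟨par, hP⟩ := exists_isParentMap hT.1 r
  obtain ⟨w, hw⟩ := hT.exists_dist_eq_three hP hru hleaf
  obtain ⟨τ, hτ⟩ := exists_isLocalPacking_univ hP
    (fun x y hx hy => (hleaf x hx).trans (hleaf y hy).symm) hw
  have hbij : Function.Bijective τ :=
    Finite.injective_iff_bijective.1 (Set.injOn_univ.1 hτ.injOn)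
  refine ⟨Equiv.ofBijective τ hbij, fun x => hτ.ne x trivial, fun x => hτ.close x trivial, ?_⟩
  intro x y h
  simp only [Equiv.ofBijective_apply]
  rcases hP.adj_cases x y h with ⟨hx, rfl⟩ | ⟨hy, rfl⟩
  · exact ⟨hτ.inner_not_adj x trivial hx trivial, hτ.inner_close x trivial hx trivial⟩
  · rw [T.adj_comm, T.edist_comm]
    exact ⟨hτ.inner_not_adj y trivial hy trivial, hτ.inner_close y trivial hy trivial⟩

/-! ### Putting the removed leaves back -/

lemma edist_map_le {V W : Type*} {G : SimpleGraph V} {H : SimpleGraph W} (φ : G →g H) (a b : V) :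
    H.edist (φ a) (φ b) ≤ G.edist a b := by
  by_cases h : G.edist a b = ⊤
  · rw [h]; exact le_top
  obtain ⟨p, hp⟩ := SimpleGraph.exists_walk_of_edist_ne_top h
  rw [← hp, ← p.length_map φ]
  exact SimpleGraph.edist_le _

/-- Two adjacent leaves of a connected graph are its only vertices. -/
lemma eq_or_eq_of_adj_leaves {V : Type*} {T : SimpleGraph V} (hT : T.Connected) {x y : V}
    (hx : IsLeaf T x) (hy : IsLeaf T y) (hxy : T.Adj x y) (z : V) : z = x ∨ z = y := by
  have h := (SimpleGraph.reachable_iff_reflTransGen x z).1 (hT x z)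
  induction h with
  | refl => exact Or.inl rfl
  | tail _ hadj ih =>
    rcases ih with rfl | rfl
    · exact Or.inr (hx.unique hadj hxy)
    · exact Or.inl (hy.unique hadj hxy.symm)

/-- The empty set is removable, so the bounded supremum is attained. -/
lemma exists_isRemovable_card_eq {V : Type*} [Fintype V] {T : SimpleGraph V}
    (hT : IsNonStarTree T) : ∃ U, IsRemovable T U ∧ U.card = maxRemovableLeaves T := by
  have hmem : (∅ : Finset V).card ∈ {m : ℕ | ∃ U : Finset V, IsRemovable T U ∧ U.card = m} := by
    refine ⟨∅, ⟨by simp, ?_⟩, rfl⟩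
    have hset : {v : V | v ∉ (∅ : Finset V)} = Set.univ := by ext; simp
    rw [hset]
    refine ⟨(SimpleGraph.induceUnivIso T).isTree_iff.2 hT.1, ?_⟩
    rintro ⟨r, hr⟩
    refine hT.2 ⟨r, ?_⟩
    ext x y
    have := congrArg (fun G : SimpleGraph _ => G.Adj ⟨x, trivial⟩ ⟨y, trivial⟩) hr
    simpa [SimpleGraph.starGraph_adj, Subtype.ext_iff] using this
  exact Nat.sSup_mem ⟨_, hmem⟩ (bddAbove_maxRemovableLeaves T)

/-- Removed leaves stay fixed, each with a label of its own. -/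
lemma IsRemovable.exists_isLabeledPacking {V : Type*} [Fintype V] {T : SimpleGraph V}
    (hT : T.Connected) {U : Finset V} (hU : IsRemovable T U) :
    ∃ f : V → Fin (U.card + 1), IsLabeledPacking T 5 (U.card + 1) f := by
  classical
  obtain ⟨hleaf, hH⟩ := hU
  obtain ⟨σ, hσ, hclose, hedge⟩ := hH.exists_perm
  obtain ⟨z, hz⟩ := hH.1.connected.nonempty
  have hle : ∀ a b : {v : V | v ∉ U},
      T.edist (a : V) b ≤ (T.induce {v : V | v ∉ U}).edist a b := fun a b =>
    edist_map_le (SimpleGraph.Embedding.induce {v : V | v ∉ U}).toHom a b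
  obtain ⟨ρ, hρU, hρ⟩ : ∃ ρ : Equiv.Perm V, (∀ v ∈ U, ρ v = v) ∧
      ∀ v : {v : V | v ∉ U}, ρ v = σ v :=
    ⟨Equiv.Perm.ofSubtype (p := fun v => v ∉ U) σ,
      fun v hv => Equiv.Perm.ofSubtype_apply_of_not_mem (p := fun v => v ∉ U) σ (by simpa using hv),
      fun v => Equiv.Perm.ofSubtype_apply_coe (p := fun v => v ∉ U) σ v⟩
  have hρne : ∀ v, v ∉ U → ρ v ∉ U ∧ ρ v ≠ v ∧ T.edist v (ρ v) ≤ 3 := by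
    intro v hv
    have h := hρ ⟨v, hv⟩
    simp only at h
    rw [h]
    exact ⟨(σ ⟨v, hv⟩).2, fun h' => hσ ⟨v, hv⟩ (Subtype.ext h'), (hle ⟨v, hv⟩ _).trans (hclose _)⟩
  have hmixed : ∀ x y, x ∈ U → y ∉ U → T.Adj x y →
      ¬ T.Adj (ρ x) (ρ y) ∧ T.edist (ρ x) (ρ y) ≤ 5 := by
    intro x y hx hy hxy
    obtain ⟨-, h2, h3⟩ := hρne y hy
    rw [hρU x hx]
    -- The only neighbour of the fixed leaf `x` is `y`, so adjacency to `ρ y` would force `ρ y = y`.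
    refine ⟨fun h => h2 ((hleaf x hx).unique h hxy), ?_⟩
    calc T.edist x (ρ y) ≤ T.edist x y + T.edist y (ρ y) := T.edist_triangle
      _ ≤ 1 + 3 := add_le_add (SimpleGraph.edist_le_one_iff_adj_or_eq.2 (Or.inl hxy)) h3
      _ ≤ 5 := by norm_num
  have hpack : ∀ x y, T.Adj x y → ¬ T.Adj (ρ x) (ρ y) ∧ T.edist (ρ x) (ρ y) ≤ 5 := by
    intro x y hxy
    by_cases hx : x ∈ U <;> by_cases hy : y ∈ U
    -- Two adjacent removed leaves would be the whole tree, but `z` survives the removal.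
    · rcases eq_or_eq_of_adj_leaves hT (hleaf x hx) (hleaf y hy) hxy z with h | h
      · exact absurd (h ▸ hx) hz
      · exact absurd (h ▸ hy) hz
    · exact hmixed x y hx hy hxy
    · rw [T.adj_comm, T.edist_comm]; exact hmixed y x hy hx hxy.symm
    · have h := hedge ⟨x, hx⟩ ⟨y, hy⟩ hxy
      have h1 := hρ ⟨x, hx⟩
      have h2 := hρ ⟨y, hy⟩
      simp only at h1 h2
      rw [h1, h2]
      exact ⟨h.1, (hle _ _).trans h.2⟩
  refine ⟨fun v => if hv : v ∈ U then (U.equivFin ⟨v, hv⟩).castSucc else Fin.last _, ?_, ρ,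
    fun x y h => (hpack x y h).1, fun x y h => ⟨fun h' => h.ne (ρ.injective h'), ?_⟩, ?_⟩
  · intro i
    induction i using Fin.lastCases with
    | last => exact ⟨z, dif_neg hz⟩
    | cast i =>
      refine ⟨U.equivFin.symm i, ?_⟩
      simp
  · exact_mod_cast (hpack x y h).2
  · intro v
    by_cases hv : v ∈ U
    · simp only [hρU v hv]
    · simp only [dif_neg hv, dif_neg (hρne v hv).1]

end LabeledPacking

theorem corollary1p4 {V : Type*} [Fintype V] (T : SimpleGraph V)
    (hT : LabeledPacking.IsNonStarTree T) :
    LabeledPacking.maxRemovableLeaves T + 1 ≤ LabeledPacking.labeledPackingNumber T 5 := by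
  obtain ⟨U, hU, hcard⟩ := LabeledPacking.exists_isRemovable_card_eq hT
  rw [← hcard]
  exact le_csSup (LabeledPacking.bddAbove_labeledPackingNumber T 5)
    ⟨Nat.succ_pos _, hU.exists_isLabeledPacking hT.1.connected⟩
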